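/- **Theorem 6.3.** Let $G=(V,E)$ be a finite, simple, connected claw-free graph (no induced $K_{1,3}$) whose clique number is $\omega(G)=\omega\ge 5$. Let $G^2$ be the square of $G$, i.e. the graph on $V$ in which two distinct vertices are adjacent if and only if they are adjacent in $G$ or joined by a two-edge path in $G$. Then at least one of the following holds: 1. $G$ is isomorphic to the line graph $L(F)$ of a finite simple graph $F$ of maximum degree $\omega$; 2. there exists a vertex $v\in V$ with $\deg_{G^2}(v)\le 2\omega(\omega-1)-4$ such that $\deg_{G^2}(x)\le 2\omega(\omega-1)-3$ for every neighbour $x$ of $v$ in $G$. -/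

import Mathlib

universe u

namespace SimpleGraph

/-- A graph is claw-free if it has no induced subgraph isomorphic to `K_{1,3}`. -/
def ClawFree {V : Type*} (G : SimpleGraph V) : Prop :=
  ¬ (completeBipartiteGraph (Fin 1) (Fin 3)).IsIndContained G

/-- The square of `G`: distinct vertices are adjacent if they are adjacent in `G` or are
connected by a two-edge path in `G`. -/
def square {V : Type*} (G : SimpleGraph V) : SimpleGraph V where
  Adj u v := u ≠ v ∧ (G.Adj u v ∨ ∃ w, G.Adj u w ∧ G.Adj w v)
  symm := ⟨fun _ _ h => ⟨h.1.symm, h.2.imp (fun a => a.symm)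
    (fun ⟨w, a, b⟩ => ⟨w, b.symm, a.symm⟩)⟩⟩

instance square.instDecidableRel {V : Type*} [Fintype V] [DecidableEq V] (G : SimpleGraph V)
    [DecidableRel G.Adj] : DecidableRel G.square.Adj := fun u v =>
  inferInstanceAs (Decidable (u ≠ v ∧ (G.Adj u v ∨ ∃ w, G.Adj u w ∧ G.Adj w v)))

end SimpleGraph

set_option linter.unusedSectionVars false
set_option linter.unusedDecidableInType false
set_option linter.unusedFintypeInType false

namespace SimpleGraph

/-! Write n = ω - 1, so cliques have at most n + 1 vertices and n ≥ 4. Call a vertex rich if it has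
the local structure recorded in `IsRich`. A square degree of at least 2n(n+1) - 3 forces this
structure (`ClawFree.isRich`): the neighbourhood is two disjoint n-cliques with no edges between
them, and the outer neighbourhoods miss at most 3 of the 2n² second neighbours conceivable. If the
second alternative fails, every vertex is rich or has a rich neighbour.

This domination gives every neighbourhood a split into two cliques joined by a matching
(`ClawFree.exists_isSplit`). Splits at the two ends of an edge yield the same clique
(`ClawFree.insert_eq_of_isSplit`), so these cliques form a Krausz partition. Its cliques are the
vertices of the root graph F and the vertices of G are its edges (`exists_lineGraph_of_krausz`); a
clique of size ω provides a vertex of degree ω. -/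

theorem ClawFree.adj {V : Type*} {G : SimpleGraph V} (h : G.ClawFree) {v a b c : V}
    (ha : G.Adj v a) (hb : G.Adj v b) (hc : G.Adj v c) (hab : a ≠ b) (hac : a ≠ c)
    (hbc : b ≠ c) : G.Adj a b ∨ G.Adj a c ∨ G.Adj b c := by
  by_contra! hn
  obtain ⟨h1, h2, h3⟩ := hn
  have h1' := fun t => h1 (G.adj_symm t)
  have h2' := fun t => h2 (G.adj_symm t)
  have h3' := fun t => h3 (G.adj_symm t)
  have hva := ha.ne
  have hvb := hb.ne
  have hvc := hc.ne
  refine h ⟨⟨⟨Sum.elim (fun _ => v) ![a, b, c], ?_⟩, ?_⟩⟩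
  · rintro (i | i) (j | j) hij
    · simp; exact Subsingleton.elim _ _
    · fin_cases j <;> simp_all
    · fin_cases i <;> simp_all
    · fin_cases i <;> fin_cases j <;> simp_all
  · intro p q
    change G.Adj (Sum.elim (fun _ => v) ![a, b, c] p) (Sum.elim (fun _ => v) ![a, b, c] q) ↔ _
    rcases p with i | i <;> rcases q with j | j
    · simp
    · fin_cases j <;> simp_all
    · fin_cases i <;> simp_all [G.adj_comm]
    · fin_cases i <;> fin_cases j <;> simp_all

/-! ### Outer neighbourhoods and clique bounds -/

variable {V : Type u} [Fintype V] [DecidableEq V] (G : SimpleGraph V) [DecidableRel G.Adj]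

/-- The neighbours of `y` outside the closed neighbourhood of `x`. -/
def outerNeighbors (x y : V) : Finset V := (G.neighborFinset y \ G.neighborFinset x).erase x

/-- The vertices at distance two from `x`. -/
def secondNeighbors (x : V) : Finset V := (G.neighborFinset x).biUnion (G.outerNeighbors x)

variable {G}

@[simp] theorem mem_outerNeighbors {x y z : V} :
    z ∈ G.outerNeighbors x y ↔ z ≠ x ∧ G.Adj y z ∧ ¬ G.Adj x z := by
  simp [outerNeighbors]

theorem mem_secondNeighbors {x z : V} :
    z ∈ G.secondNeighbors x ↔ z ≠ x ∧ ¬ G.Adj x z ∧ ∃ y, G.Adj x y ∧ G.Adj y z := by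
  simp only [secondNeighbors, Finset.mem_biUnion, mem_neighborFinset, mem_outerNeighbors]
  grind

theorem square_degree (x : V) :
    G.square.degree x = G.degree x + (G.secondNeighbors x).card := by
  have hd : Disjoint (G.neighborFinset x) (G.secondNeighbors x) := by
    rw [Finset.disjoint_left]
    intro z hz hz'
    rw [mem_neighborFinset] at hz
    exact (mem_secondNeighbors.1 hz').2.1 hz
  rw [← card_neighborFinset_eq_degree, ← card_neighborFinset_eq_degree,
    ← Finset.card_union_of_disjoint hd]
  congr 1
  ext z
  simp only [mem_neighborFinset, Finset.mem_union, mem_secondNeighbors]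
  constructor
  · rintro ⟨h1, h2⟩
    by_cases hz : G.Adj x z
    · exact Or.inl hz
    · exact Or.inr ⟨h1.symm, hz, h2.resolve_left hz⟩
  · rintro (h | ⟨h1, _, h2⟩)
    · exact ⟨h.ne, Or.inl h⟩
    · exact ⟨h1.symm, Or.inr h2⟩

theorem isClique_insert_finset {s : Finset V} {a : V} (hs : G.IsClique (s : Set V))
    (h : ∀ b ∈ s, G.Adj a b) : G.IsClique ((insert a s : Finset V) : Set V) := by
  rw [Finset.coe_insert]
  exact hs.insert fun b hb _ => h b hb

namespace ClawFree

variable (hG : G.ClawFree)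
include hG

theorem isClique_outerNeighbors {x y : V} (hxy : G.Adj x y) :
    G.IsClique (G.outerNeighbors x y : Set V) := by
  intro a ha b hb hab
  simp only [Finset.mem_coe, mem_outerNeighbors] at ha hb
  have := hG.adj hxy.symm ha.2.1 hb.2.1 ha.1.symm hb.1.symm hab
  tauto

theorem card_outerNeighbors_le {n : ℕ} (hn : ∀ s : Finset V, G.IsClique (s : Set V) → s.card ≤ n + 1)
    {x y : V} (hxy : G.Adj x y) : (G.outerNeighbors x y).card ≤ n := by
  have h := hn _ (isClique_insert_finset (a := y) (hG.isClique_outerNeighbors hxy) fun b hb =>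
    (mem_outerNeighbors.1 hb).2.1)
  rw [Finset.card_insert_of_notMem (by simp)] at h
  omega

theorem isClique_nonneighbors {x y : V} (hxy : G.Adj x y) :
    G.IsClique (((G.neighborFinset x).filter fun z => z ≠ y ∧ ¬ G.Adj y z : Finset V) : Set V) := by
  intro a ha b hb hab
  simp only [Finset.mem_coe, Finset.mem_filter, mem_neighborFinset] at ha hb
  have := hG.adj hxy ha.1 hb.1 ha.2.1.symm hb.2.1.symm hab
  tauto

end ClawFree

/-- A graph without independent triples and cliques on more than `n` vertices is small. -/
theorem card_le_of_no_independent_triple (n : ℕ) : ∀ s : Finset V,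
    (∀ a ∈ s, ∀ b ∈ s, ∀ c ∈ s, a ≠ b → a ≠ c → b ≠ c → G.Adj a b ∨ G.Adj a c ∨ G.Adj b c) →
    (∀ t ⊆ s, G.IsClique (t : Set V) → t.card ≤ n) → 2 * s.card ≤ n * (n + 3) := by
  induction n with
  | zero =>
    intro s _ h
    rcases s.eq_empty_or_nonempty with rfl | ⟨a, ha⟩
    · simp
    · have := h {a} (by simpa using ha) (by simp)
      simp at this
  | succ n ih =>
    intro s h3 h
    rcases s.eq_empty_or_nonempty with rfl | ⟨a, ha⟩
    · simp
    -- Neighbours of a have clique bound n, since a can be added; non-neighbours other than a form a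
    -- clique of size at most n + 1.
    have h1 := ih (s.filter fun z => G.Adj a z)
      (fun p hp q hq r hr => h3 p (Finset.mem_of_mem_filter _ hp) q (Finset.mem_of_mem_filter _ hq)
        r (Finset.mem_of_mem_filter _ hr)) (fun t ht hc => by
        have := h (insert a t) (by grind) (isClique_insert_finset hc (by grind))
        rw [Finset.card_insert_of_notMem (by grind [G.irrefl])] at this
        omega)
    have h2 := h ((s.filter fun z => ¬ G.Adj a z).erase a) (by grind) (by
      intro p hp q hq hpq
      simp only [Finset.mem_coe, Finset.mem_erase, Finset.mem_filter] at hp hq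
      have := h3 a ha p hp.2.1 q hq.2.1 hp.1.symm hq.1.symm hpq
      tauto)
    rw [Finset.card_erase_of_mem (by simp [ha])] at h2
    have h4 := Finset.card_filter_add_card_filter_not (s := s) (fun z => G.Adj a z)
    nlinarith [Nat.sub_le_iff_le_add.1 h2]

/-! ### Double counting second neighbours -/

namespace ClawFree

/-- If the neighbourhood of `x` is not covered by two cliques, then every vertex at distance two
from `x` has many common neighbours with `x`. -/
theorem le_card_commonNeighbors (hG : G.ClawFree) {n : ℕ}
    (hn : ∀ s : Finset V, G.IsClique (s : Set V) → s.card ≤ n + 1) {x w : V}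
    (hx : ¬ ∃ A B : Finset V, G.IsClique (A : Set V) ∧ G.IsClique (B : Set V) ∧
      Disjoint A B ∧ A ∪ B = G.neighborFinset x)
    (hw : w ∈ G.secondNeighbors x) :
    2 ≤ ((G.neighborFinset x).filter fun y => G.Adj y w).card ∧
    G.degree x + 1 ≤ ((G.neighborFinset x).filter fun y => G.Adj y w).card + 2 * n := by
  obtain ⟨hwx, hxw, y, hxy, hyw⟩ := mem_secondNeighbors.1 hw
  -- P with y is a clique by claw-freeness at y (against w), Q by claw-freeness at x (against y). If
  -- y were the only common neighbour of x and w, these two would cover the neighbourhood of x.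
  set P : Finset V := (G.neighborFinset x).filter fun z => G.Adj y z ∧ ¬ G.Adj z w with hP
  set Q : Finset V := (G.neighborFinset x).filter fun z => z ≠ y ∧ ¬ G.Adj y z with hQ
  set M : Finset V := (G.neighborFinset x).filter fun z => G.Adj z w with hM
  have hyM : y ∈ M := by simp [hM, hxy, hyw]
  have cP : G.IsClique ((insert y P : Finset V) : Set V) := by
    apply isClique_insert_finset
    · intro a ha b hb hab
      simp only [hP, Finset.mem_coe, Finset.mem_filter, mem_neighborFinset] at ha hb
      have := hG.adj hyw ha.2.1 hb.2.1 (by grind [G.adj_comm]) (by grind [G.adj_comm]) hab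
      grind [G.adj_comm]
    · intro b hb
      exact (Finset.mem_filter.1 hb).2.1
  have cQ : G.IsClique (Q : Set V) := hG.isClique_nonneighbors hxy
  have hyP : y ∉ P := by simp [hP]
  have hcover : G.neighborFinset x ⊆ M ∪ (P ∪ Q) := by
    intro z hz
    by_cases h1 : G.Adj z w <;> by_cases h2 : G.Adj y z <;> by_cases h3 : z = y <;>
      simp_all
  constructor
  · by_contra! hlt
    have hMy : M = {y} := by
      symm
      apply Finset.eq_of_subset_of_card_le
      · simpa using hyM
      · simp; omega
    refine hx ⟨insert y P, Q, cP, cQ, ?_, ?_⟩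
    · rw [Finset.disjoint_left]
      intro a ha hb
      simp only [hP, hQ, Finset.mem_insert, Finset.mem_filter] at ha hb
      tauto
    · apply le_antisymm
      · intro z hz
        simp only [hP, hQ, Finset.mem_union, Finset.mem_insert, Finset.mem_filter] at hz
        rcases hz with (rfl | h) | h
        · simpa using hxy
        · exact h.1
        · exact h.1
      · intro z hz
        have := hcover hz
        rw [hMy] at this
        simpa [or_assoc] using this
  · have h1 := hn (insert x (insert y P)) (isClique_insert_finset cP (by
      intro b hb
      simp only [hP, Finset.mem_insert, Finset.mem_filter, mem_neighborFinset] at hb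
      rcases hb with rfl | h
      · exact hxy
      · exact h.1))
    rw [Finset.card_insert_of_notMem, Finset.card_insert_of_notMem hyP] at h1
    · have h2 := hn (insert x Q) (isClique_insert_finset cQ (by
        intro b hb
        simpa using Finset.mem_of_mem_filter _ hb))
      rw [Finset.card_insert_of_notMem (by simp [hQ])] at h2
      have h3 := Finset.card_le_card hcover
      have h4 := Finset.card_union_le M (P ∪ Q)
      have h5 := Finset.card_union_le P Q
      rw [card_neighborFinset_eq_degree] at h3
      omega
    · simp [hP, hxy.ne]

theorem two_mul_degree_le (hG : G.ClawFree) {n : ℕ}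
    (hn : ∀ s : Finset V, G.IsClique (s : Set V) → s.card ≤ n + 1) (x : V) :
    2 * G.degree x ≤ n * (n + 3) := by
  rw [← card_neighborFinset_eq_degree]
  apply card_le_of_no_independent_triple (G := G)
  · intro a ha b hb c hc
    simp only [mem_neighborFinset] at ha hb hc
    exact hG.adj ha hb hc
  · intro t ht hc
    have := hn (insert x t) (isClique_insert_finset hc fun b hb => by simpa using ht hb)
    rw [Finset.card_insert_of_notMem (fun h => by simpa using ht h)] at this
    omega

/-- Otherwise second neighbours are hit so often from the neighbourhood that there are too few of
them. -/
theorem exists_two_cliques (hG : G.ClawFree) {n : ℕ} (hn4 : 4 ≤ n)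
    (hn : ∀ s : Finset V, G.IsClique (s : Set V) → s.card ≤ n + 1) {x : V}
    (hx : 2 * (n + 1) * n ≤ G.square.degree x + 3) :
    ∃ A B : Finset V, G.IsClique (A : Set V) ∧ G.IsClique (B : Set V) ∧
      Disjoint A B ∧ A ∪ B = G.neighborFinset x := by
  by_contra hcon
  have hd := hG.two_mul_degree_le hn x
  rw [square_degree] at hx
  have key : ∀ m : ℕ, (∀ w ∈ G.secondNeighbors x,
      m ≤ ((G.neighborFinset x).filter fun y => G.Adj y w).card) →
      (G.secondNeighbors x).card * m ≤ G.degree x * n := by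
    intro m hm
    rw [← card_neighborFinset_eq_degree]
    refine Finset.card_mul_le_card_mul (fun w y => G.Adj y w) hm ?_
    intro y hy
    rw [mem_neighborFinset] at hy
    refine (Finset.card_le_card ?_).trans (hG.card_outerNeighbors_le hn hy)
    intro w hw
    simp only [Finset.bipartiteBelow, Finset.mem_filter, mem_secondNeighbors] at hw
    rw [mem_outerNeighbors]
    tauto
  have h2 := key 2 fun w hw => (hG.le_card_commonNeighbors hn hcon hw).1
  have h3 := key (G.degree x + 1 - 2 * n) fun w hw => by
    have := (hG.le_card_commonNeighbors hn hcon hw).2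
    omega
  generalize G.degree x = d at *
  generalize (G.secondNeighbors x).card = s at *
  -- Up to degree 2n the multiplicity 2 suffices. Beyond it the multiplicity is k + 2: if k + 2 < n
  -- the count stays at most n(2n+1)/2, otherwise s ≤ d and the quadratic bound on d finishes.
  rcases Nat.lt_or_ge d (2 * n + 1) with h | h
  · nlinarith
  · obtain ⟨k, rfl⟩ : ∃ k, d = 2 * n + 1 + k := ⟨d - (2 * n + 1), by omega⟩
    rw [show 2 * n + 1 + k + 1 - 2 * n = k + 2 by omega] at h3
    rcases Nat.lt_or_ge (k + 2) n with hk | hk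
    · have h4 : s * (k + 2) * 2 ≤ (2 * n + 1) * n * (k + 2) := by nlinarith
      have h5 : s * 2 ≤ (2 * n + 1) * n := by
        have : 0 < k + 2 := by omega
        nlinarith
      nlinarith
    · have h4 : s * n ≤ (2 * n + 1 + k) * n := (Nat.mul_le_mul_left s hk).trans h3
      have h5 : s ≤ 2 * n + 1 + k := Nat.le_of_mul_le_mul_right h4 (by omega)
      nlinarith

end ClawFree

/-! ### Rich vertices -/

/-- The local structure around a vertex whose degree in the square is nearly maximal. -/
structure IsRich (G : SimpleGraph V) [DecidableRel G.Adj] (n : ℕ) (x : V) : Prop where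
  exists_cliques : ∃ A B : Finset V, G.IsClique (A : Set V) ∧ G.IsClique (B : Set V) ∧
    Disjoint A B ∧ A ∪ B = G.neighborFinset x ∧ A.card = n ∧ B.card = n ∧
    ∀ a ∈ A, ∀ b ∈ B, ¬ G.Adj a b
  trans : ∀ p q r, G.Adj x p → G.Adj x q → G.Adj x r → G.Adj p q → G.Adj q r → p ≠ r → G.Adj p r
  no_three : ∀ z p q r, z ≠ x → ¬ G.Adj x z → G.Adj x p → G.Adj x q → G.Adj x r →
    G.Adj z p → G.Adj z q → G.Adj z r → p ≠ q → p ≠ r → q ≠ r → False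
  le_card_biUnion : ∀ Y ⊆ G.neighborFinset x, Y.card * n ≤ (Y.biUnion (G.outerNeighbors x)).card + 3

/-- Each neighbour contributes at most n second neighbours, so the total slack is 3. Every forbidden
configuration would waste at least n > 3. -/
theorem ClawFree.isRich (hG : G.ClawFree) {n : ℕ} (hn4 : 4 ≤ n)
    (hn : ∀ s : Finset V, G.IsClique (s : Set V) → s.card ≤ n + 1) {x : V}
    (hx : 2 * (n + 1) * n ≤ G.square.degree x + 3) : G.IsRich n x := by
  obtain ⟨A, B, cA, cB, hAB, hcov⟩ := hG.exists_two_cliques hn4 hn hx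
  have hmem : ∀ z, G.Adj x z ↔ z ∈ A ∨ z ∈ B := fun z => by
    rw [← mem_neighborFinset, ← hcov, Finset.mem_union]
  have hadd : A.card + B.card = G.degree x := by
    rw [← card_neighborFinset_eq_degree, ← hcov, Finset.card_union_of_disjoint hAB]
  have small : ∀ S : Finset V, G.IsClique (S : Set V) → (∀ z ∈ S, G.Adj x z) → S.card ≤ n := by
    intro S hS h
    have := hn _ (isClique_insert_finset hS h)
    rw [Finset.card_insert_of_notMem (fun h' => G.irrefl (h x h'))] at this
    omega
  have hA := small A cA fun z hz => (hmem z).2 (Or.inl hz)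
  have hB := small B cB fun z hz => (hmem z).2 (Or.inr hz)
  rw [square_degree] at hx
  have bU : ∀ Y ⊆ G.neighborFinset x, (Y.biUnion (G.outerNeighbors x)).card ≤ Y.card * n := by
    intro Y hY
    refine Finset.card_biUnion_le_card_mul _ _ _ fun y hy => ?_
    exact hG.card_outerNeighbors_le hn (by simpa using hY hy)
  have hS := bU _ (Finset.Subset.refl _)
  rw [card_neighborFinset_eq_degree] at hS
  change (G.secondNeighbors x).card ≤ _ at hS
  have hdeg : G.degree x = 2 * n := by
    apply le_antisymm (by omega)
    by_contra! hlt
    have : G.degree x + 1 ≤ 2 * n := hlt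
    nlinarith
  rw [hdeg] at hx hS hadd
  have hS' : 2 * n * n ≤ (G.secondNeighbors x).card + 3 := by nlinarith
  have hU : ∀ Y ⊆ G.neighborFinset x,
      Y.card * n ≤ (Y.biUnion (G.outerNeighbors x)).card + 3 := by
    intro Y hY
    have h1 : (G.secondNeighbors x).card ≤ (Y.biUnion (G.outerNeighbors x)).card +
        ((G.neighborFinset x \ Y).biUnion (G.outerNeighbors x)).card := by
      refine le_trans (Finset.card_le_card ?_) (Finset.card_union_le _ _)
      rw [← Finset.union_biUnion, Finset.union_sdiff_of_subset hY]
      exact Finset.Subset.refl _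
    have h2 := bU (G.neighborFinset x \ Y) Finset.sdiff_subset
    have h3 := Finset.card_sdiff_add_card_eq_card hY
    rw [card_neighborFinset_eq_degree, hdeg] at h3
    rw [← h3] at hS'
    nlinarith
  have cross : ∀ A B : Finset V, G.IsClique (A : Set V) → A.card = n → Disjoint A B →
      (∀ z, G.Adj x z ↔ z ∈ A ∨ z ∈ B) → ∀ v ∈ A, ∀ b ∈ B, ¬ G.Adj v b := by
    intro A B cA hA hAB hmem v hv b hb hvb
    have hxv := (hmem v).2 (Or.inl hv)
    have hxb := (hmem b).2 (Or.inr hb)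
    have hbA : b ∉ A := Finset.disjoint_right.1 hAB hb
    obtain ⟨a, ha, hab⟩ : ∃ a ∈ A, ¬ G.Adj b a := by
      by_contra! h
      have := small _ (isClique_insert_finset cA h) (by
        intro z hz
        rcases Finset.mem_insert.1 hz with rfl | hz
        · exact hxb
        · exact (hmem z).2 (Or.inl hz))
      rw [Finset.card_insert_of_notMem hbA] at this
      omega
    have hva : v ≠ a := by
      rintro rfl
      exact hab hvb.symm
    -- An edge from v to b makes v redundant: each outer neighbour of v is also seen from a or b, by
    -- claw-freeness at v.
    have hsub : G.secondNeighbors x ⊆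
        ((G.neighborFinset x).erase v).biUnion (G.outerNeighbors x) := by
      intro c hc
      obtain ⟨hcx, hxc, y, hxy, hyc⟩ := mem_secondNeighbors.1 hc
      suffices h : ∃ z, z ≠ v ∧ G.Adj x z ∧ G.Adj z c by
        obtain ⟨z, h1, h2, h3⟩ := h
        exact Finset.mem_biUnion.2 ⟨z, by simp [h1, h2], mem_outerNeighbors.2 ⟨hcx, h3, hxc⟩⟩
      by_cases hyv : y = v
      · subst hyv
        have hxa := (hmem a).2 (Or.inl ha)
        have := hG.adj (cA hv ha hva) hvb hyc (by grind) (by grind) (by grind)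
        rcases this with h | h | h
        · exact absurd h.symm hab
        · exact ⟨a, hva.symm, hxa, h⟩
        · exact ⟨b, hvb.ne.symm, hxb, h⟩
      · exact ⟨y, hyv, hxy, hyc⟩
    have h1 := (Finset.card_le_card hsub).trans (bU _ (Finset.erase_subset _ _))
    rw [Finset.card_erase_of_mem (by simpa using hxv), card_neighborFinset_eq_degree, hdeg,
      Nat.sub_mul] at h1
    have h2 : n ≤ 2 * n * n := by nlinarith
    omega
  have hA' : A.card = n := by omega
  have hB' : B.card = n := by omega
  have hcAB := cross A B cA hA' hAB hmem
  refine ⟨⟨A, B, cA, cB, hAB, hcov, hA', hB', hcAB⟩, ?_, ?_, hU⟩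
  · intro p q r hp hq hr hpq hqr hpr
    rw [hmem] at hp hq hr
    rcases hp with hp | hp <;> rcases hq with hq | hq <;> rcases hr with hr | hr
    · exact cA hp hr hpr
    · exact absurd hqr (hcAB q hq r hr)
    · exact absurd hpq (hcAB p hp q hq)
    · exact absurd hpq (hcAB p hp q hq)
    · exact absurd hpq.symm (hcAB q hq p hp)
    · exact absurd hpq.symm (hcAB q hq p hp)
    · exact absurd hqr.symm (hcAB r hr q hq)
    · exact cB hp hr hpr
  · intro z p q r hzx hxz hp hq hr zp zq zr hpq hpr hqr
    -- T is a clique by claw-freeness at z against p, and z extends it. So p, q, r together reach at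
    -- most 2n vertices, fewer than the required 3n - 3.
    set T := (G.outerNeighbors x q ∪ G.outerNeighbors x r) \ G.outerNeighbors x p with hT
    have hzT : ∀ y ∈ T, G.Adj z y := by
      intro y hy
      simp only [hT, Finset.mem_sdiff, Finset.mem_union, mem_outerNeighbors] at hy
      have hyz : z ≠ y := by
        rintro rfl
        exact hy.2 ⟨hzx, zp.symm, hxz⟩
      rcases hy.1 with h | h
      · exact hG.isClique_outerNeighbors hq (by simp [hzx, zq.symm, hxz]) (by simpa using h) hyz
      · exact hG.isClique_outerNeighbors hr (by simp [hzx, zr.symm, hxz]) (by simpa using h) hyz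
    have cT : G.IsClique (T : Set V) := by
      intro a ha b hb hab
      have haz := hzT a ha
      have hbz := hzT b hb
      simp only [hT, Finset.mem_coe, Finset.mem_sdiff, Finset.mem_union, mem_outerNeighbors]
        at ha hb
      have := hG.adj zp haz hbz (by grind) (by grind) hab
      grind
    have h1 := hn _ (isClique_insert_finset cT hzT)
    rw [Finset.card_insert_of_notMem fun h => G.irrefl (hzT z h)] at h1
    have h2 := hU {p, q, r} (by
      intro y hy
      simp only [Finset.mem_insert, Finset.mem_singleton] at hy
      rcases hy with rfl | rfl | rfl <;> simpa)
    rw [Finset.card_eq_three.2 ⟨p, q, r, hpq, hpr, hqr, rfl⟩] at h2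
    have h3 : (({p, q, r} : Finset V).biUnion (G.outerNeighbors x)).card ≤
        (G.outerNeighbors x p).card + T.card := by
      refine le_trans (Finset.card_le_card ?_) (Finset.card_union_le _ _)
      intro y hy
      simp only [Finset.mem_biUnion, Finset.mem_insert, Finset.mem_singleton] at hy
      simp only [hT, Finset.mem_union, Finset.mem_sdiff]
      obtain ⟨a, rfl | rfl | rfl, h⟩ := hy <;> tauto
    have h4 := hG.card_outerNeighbors_le hn hp
    omega

theorem IsRich.le_card_union {n : ℕ} {x a b : V} (hx : G.IsRich n x) (ha : G.Adj x a)
    (hb : G.Adj x b) (hab : a ≠ b) :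
    2 * n ≤ (G.outerNeighbors x a ∪ G.outerNeighbors x b).card + 3 := by
  have := hx.le_card_biUnion {a, b} (by simp [Finset.insert_subset_iff, ha, hb])
  rwa [Finset.card_pair hab, Finset.biUnion_insert, Finset.singleton_biUnion] at this

theorem IsRich.le_card_outerNeighbors {n : ℕ} {x a : V} (hx : G.IsRich n x) (ha : G.Adj x a) :
    n ≤ (G.outerNeighbors x a).card + 3 := by
  have := hx.le_card_biUnion {a} (by simpa using ha)
  simpa using this

/-- Rich vertices cannot dominate a `K₄` on `a, b, c, d` with triangles attached to `a, c, d` and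
to `b, c, d`. -/
theorem ClawFree.not_rich_of_two_triangles (hG : G.ClawFree) {n : ℕ}
    (hdom : ∀ v, G.IsRich n v ∨ ∃ x, G.Adj x v ∧ G.IsRich n x)
    {a b c d r s : V} (ab : G.Adj a b) (ac : G.Adj a c) (ad : G.Adj a d) (bc : G.Adj b c)
    (bd : G.Adj b d) (cd : G.Adj c d) (ra : G.Adj r a) (rc : G.Adj r c) (rd : G.Adj r d)
    (sb : G.Adj s b) (sc : G.Adj s c) (sd : G.Adj s d) (rb : ¬ G.Adj r b) (sa : ¬ G.Adj s a)
    (hrb : r ≠ b) (hsa : s ≠ a) (hrs : r ≠ s) : False := by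
  rcases hdom c with hc | ⟨y, yc, hy⟩
  · exact rb (hc.trans r a b rc.symm ac.symm bc.symm ra ab hrb)
  have hya : y ≠ a := by
    rintro rfl
    exact rb (hy.trans r c b ra.symm ac ab rc bc.symm hrb)
  have hyb : y ≠ b := by
    rintro rfl
    exact sa (hy.trans s c a sb.symm bc ab.symm sc ac.symm hsa)
  have hyd : y ≠ d := by
    rintro rfl
    exact rb (hy.trans r a b rd.symm ad.symm bd.symm ra ab hrb)
  have hyr : y ≠ r := by
    rintro rfl
    exact hy.no_three b a c d hrb.symm rb ra rc rd ab.symm bc bd ac.ne ad.ne cd.ne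
  have hys : y ≠ s := by
    rintro rfl
    exact hy.no_three a b c d hsa.symm sa sb sc sd ab ac ad bc.ne bd.ne cd.ne
  -- Claw-freeness at c restricts how y meets r, b and s, a. Each case breaks transitivity at y or
  -- gives a vertex outside its neighbourhood with three neighbours inside.
  have yrb := hG.adj yc.symm rc.symm bc.symm hyr hyb hrb
  have ysa := hG.adj yc.symm sc.symm ac.symm hys hya hsa
  have three := hy.no_three
  by_cases ya : G.Adj y a <;> by_cases yb : G.Adj y b
  · have yr : ¬ G.Adj y r := fun h => rb (hy.trans r a b h ya yb ra ab hrb)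
    by_cases yd : G.Adj y d
    · exact three r c a d hyr.symm yr yc ya yd rc ra rd ac.ne.symm cd.ne ad.ne
    · exact three d c a b hyd.symm yd yc ya yb cd.symm ad.symm bd.symm ac.ne.symm bc.ne.symm ab.ne
  · have yr : G.Adj y r := by tauto
    by_cases yd : G.Adj y d
    · exact three b c d a hyb.symm yb yc yd ya bc bd ab.symm cd.ne ac.ne.symm ad.ne.symm
    · exact three d c a r hyd.symm yd yc ya yr cd.symm ad.symm rd.symm ac.ne.symm rc.ne.symm
        ra.ne.symm
  · have ys : G.Adj y s := by tauto
    by_cases yd : G.Adj y d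
    · exact three a c d b hya.symm ya yc yd yb ac ad ab cd.ne bc.ne.symm bd.ne.symm
    · exact three d c b s hyd.symm yd yc yb ys cd.symm bd.symm sd.symm bc.ne.symm sc.ne.symm
        sb.ne.symm
  · have yr : G.Adj y r := by tauto
    have ys : G.Adj y s := by tauto
    by_cases yd : G.Adj y d
    · exact three a c d r hya.symm ya yc yd yr ac ad ra.symm cd.ne rc.ne.symm rd.ne.symm
    · exact three d c r s hyd.symm yd yc yr ys cd.symm rd.symm sd.symm rc.ne.symm sc.ne.symm hrs

/-- Two adjacent neighbours of a rich vertex have at most one common outer neighbour. -/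
theorem ClawFree.eq_of_mem_outerNeighbors (hG : G.ClawFree) {n : ℕ} (hn4 : 4 ≤ n)
    (hn : ∀ s : Finset V, G.IsClique (s : Set V) → s.card ≤ n + 1)
    (hdom : ∀ v, G.IsRich n v ∨ ∃ x, G.Adj x v ∧ G.IsRich n x)
    {x a b c d : V} (hx : G.IsRich n x) (xa : G.Adj x a) (xb : G.Adj x b) (ab : G.Adj a b)
    (hca : c ∈ G.outerNeighbors x a) (hcb : c ∈ G.outerNeighbors x b)
    (hda : d ∈ G.outerNeighbors x a) (hdb : d ∈ G.outerNeighbors x b) : c = d := by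
  by_contra hcd
  have rest : ∀ a b, G.Adj x a → G.Adj x b → a ≠ b →
      ∃ r ∈ G.outerNeighbors x a, r ∉ G.outerNeighbors x b := by
    intro a b xa xb hab
    by_contra! hsub
    have h := hx.le_card_union xa xb hab
    rw [Finset.union_eq_right.2 hsub] at h
    have := hG.card_outerNeighbors_le hn xb
    omega
  -- The two outer neighbourhoods have a union of size at least 2n - 3 > n, so neither contains the
  -- other.
  obtain ⟨r, hra, hrb⟩ := rest a b xa xb ab.ne
  obtain ⟨s, hsb, hsa⟩ := rest b a xb xa ab.ne.symm
  have rc := hG.isClique_outerNeighbors xa hra hca (by rintro rfl; exact hrb hcb)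
  have rd := hG.isClique_outerNeighbors xa hra hda (by rintro rfl; exact hrb hdb)
  have sc := hG.isClique_outerNeighbors xb hsb hcb (by rintro rfl; exact hsa hca)
  have sd := hG.isClique_outerNeighbors xb hsb hdb (by rintro rfl; exact hsa hda)
  have cd := hG.isClique_outerNeighbors xa hca hda hcd
  simp only [mem_outerNeighbors] at *
  obtain ⟨rx, ar, xr⟩ := hra
  have br : ¬ G.Adj b r := fun h => hrb ⟨rx, h, xr⟩
  obtain ⟨sx, bs, xs⟩ := hsb
  have as : ¬ G.Adj a s := fun h => hsa ⟨sx, h, xs⟩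
  have ac := hca.2.1
  have bc := hcb.2.1
  have ad := hda.2.1
  have bd := hdb.2.1
  have hrb' : r ≠ b := by rintro rfl; exact xr xb
  have hsa' : s ≠ a := by rintro rfl; exact xs xa
  have hrs : r ≠ s := by rintro rfl; exact as ar
  exact hG.not_rich_of_two_triangles hdom ab ac ad bc bd cd ar.symm rc rd bs.symm sc sd
    (fun h => br h.symm) (fun h => as h.symm) hrb' hsa' hrs

/-! ### Splits and their compatibility along edges -/

/-- A partition of the neighbourhood of `v` into two cliques joined by a matching. -/
structure IsSplit (G : SimpleGraph V) (v : V) (X Y : Finset V) : Prop where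
  left : G.IsClique (X : Set V)
  right : G.IsClique (Y : Set V)
  disjoint : Disjoint X Y
  mem : ∀ z, G.Adj v z ↔ z ∈ X ∨ z ∈ Y
  left_unique : ∀ y ∈ Y, ∀ p ∈ X, ∀ q ∈ X, G.Adj y p → G.Adj y q → p = q
  right_unique : ∀ y ∈ X, ∀ p ∈ Y, ∀ q ∈ Y, G.Adj y p → G.Adj y q → p = q

theorem IsSplit.symm {v : V} {X Y : Finset V} (h : G.IsSplit v X Y) : G.IsSplit v Y X :=
  ⟨h.right, h.left, h.disjoint.symm, fun z => (h.mem z).trans or_comm, h.right_unique,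
    h.left_unique⟩

/-- A side of a split is proper if it is large or comes from a rich neighbour. -/
def IsProperSide (G : SimpleGraph V) [DecidableRel G.Adj] (n : ℕ) (v : V) (X : Finset V) : Prop :=
  n ≤ X.card ∨ ∃ x, G.Adj x v ∧ G.IsRich n x ∧ X = G.outerNeighbors x v

/-- At a vertex with a rich neighbour x, one side is the clique of x through v, with x replacing v.
The matching property comes from `no_three` in one direction and from `eq_of_mem_outerNeighbors` in
the other. -/
theorem ClawFree.exists_isSplit (hG : G.ClawFree) {n : ℕ} (hn4 : 4 ≤ n)
    (hn : ∀ s : Finset V, G.IsClique (s : Set V) → s.card ≤ n + 1)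
    (hdom : ∀ v, G.IsRich n v ∨ ∃ x, G.Adj x v ∧ G.IsRich n x) (v : V) :
    ∃ X Y, G.IsSplit v X Y ∧ X.card = n ∧ Y.Nonempty ∧ G.IsProperSide n v Y := by
  rcases hdom v with hv | ⟨x, xv, hx⟩
  · obtain ⟨A, B, cA, cB, hAB, hcov, hA, hB, hc⟩ := hv.exists_cliques
    have hmem : ∀ z, G.Adj v z ↔ z ∈ A ∨ z ∈ B := fun z => by
      rw [← mem_neighborFinset, ← hcov, Finset.mem_union]
    refine ⟨A, B, ⟨cA, cB, hAB, hmem, ?_, ?_⟩, hA, Finset.card_pos.1 (by omega), Or.inl hB.ge⟩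
    · intro y hy p hp q _ h
      exact absurd h.symm (hc p hp y hy)
    · intro y hy p hp q _ h
      exact absurd h (hc y hy p hp)
  · obtain ⟨A, hvA, cA, hA, hAx, hAN⟩ : ∃ A : Finset V, v ∈ A ∧ G.IsClique (A : Set V) ∧
        A.card = n ∧ (∀ z ∈ A, G.Adj x z) ∧ ∀ z, G.Adj x z → G.Adj v z → z ∈ A := by
      obtain ⟨A, B, cA, cB, hAB, hcov, hA, hB, hc⟩ := hx.exists_cliques
      have hmem : ∀ z, G.Adj x z ↔ z ∈ A ∨ z ∈ B := fun z => by
        rw [← mem_neighborFinset, ← hcov, Finset.mem_union]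
      rcases (hmem v).1 xv with h | h
      · exact ⟨A, h, cA, hA, fun z hz => (hmem z).2 (Or.inl hz), fun z hz hvz =>
          ((hmem z).1 hz).resolve_right fun hz' => hc v h z hz' hvz⟩
      · exact ⟨B, h, cB, hB, fun z hz => (hmem z).2 (Or.inr hz), fun z hz hvz =>
          ((hmem z).1 hz).resolve_left fun hz' => hc z hz' v h hvz.symm⟩
    have hxA : x ∉ A := fun h => G.irrefl (hAx x h)
    refine ⟨insert x (A.erase v), G.outerNeighbors x v, ⟨?_, hG.isClique_outerNeighbors xv,
      ?_, ?_, ?_, ?_⟩, ?_, ?_, Or.inr ⟨x, xv, hx, rfl⟩⟩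
    · refine isClique_insert_finset (cA.subset (by simp)) fun z hz => ?_
      exact hAx z (Finset.mem_of_mem_erase hz)
    · rw [Finset.disjoint_left]
      intro z hz hz'
      rw [mem_outerNeighbors] at hz'
      rcases Finset.mem_insert.1 hz with h | h
      · exact hz'.1 h
      · exact hz'.2.2 (hAx z (Finset.mem_of_mem_erase h))
    · intro z
      rw [Finset.mem_insert, Finset.mem_erase, mem_outerNeighbors]
      constructor
      · intro h
        by_cases hzx : z = x
        · exact Or.inl (Or.inl hzx)
        · by_cases hxz : G.Adj x z
          · exact Or.inl (Or.inr ⟨h.ne.symm, hAN z hxz h⟩)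
          · exact Or.inr ⟨hzx, h, hxz⟩
      · rintro ((rfl | ⟨h1, h2⟩) | h)
        · exact xv.symm
        · exact cA hvA h2 h1.symm
        · exact h.2.1
    · intro y hy p hp q hq hyp hyq
      by_contra hpq
      rw [mem_outerNeighbors] at hy
      rw [Finset.mem_insert, Finset.mem_erase] at hp hq
      have hp' := hp.resolve_left (by rintro rfl; exact hy.2.2 hyp.symm)
      have hq' := hq.resolve_left (by rintro rfl; exact hy.2.2 hyq.symm)
      exact hx.no_three y v p q hy.1 hy.2.2 xv (hAx p hp'.2) (hAx q hq'.2) hy.2.1.symm hyp hyq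
        hp'.1.symm hq'.1.symm hpq
    · intro y hy p hp q hq hyp hyq
      rw [Finset.mem_insert, Finset.mem_erase] at hy
      have hp' := mem_outerNeighbors.1 hp
      have hq' := mem_outerNeighbors.1 hq
      rcases hy with rfl | ⟨h1, h2⟩
      · exact absurd hyp hp'.2.2
      · exact hG.eq_of_mem_outerNeighbors hn4 hn hdom hx xv (hAx y h2) (cA hvA h2 h1.symm) hp
          (mem_outerNeighbors.2 ⟨hp'.1, hyp, hp'.2.2⟩) hq
          (mem_outerNeighbors.2 ⟨hq'.1, hyq, hq'.2.2⟩)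
    · rw [Finset.card_insert_of_notMem (fun h => hxA (Finset.mem_of_mem_erase h)),
        Finset.card_erase_of_mem hvA]
      omega
    · have := hx.le_card_outerNeighbors xv
      exact Finset.card_pos.1 (by omega)

/-- Splits at the two ends of an edge agree on the clique containing that edge. -/
theorem ClawFree.mem_of_isSplit (hG : G.ClawFree) {n : ℕ} (hn4 : 4 ≤ n)
    (hn : ∀ s : Finset V, G.IsClique (s : Set V) → s.card ≤ n + 1)
    {v u : V} {X X' Z Z' : Finset V} (hv : G.IsSplit v X X') (hu : G.IsSplit u Z Z')
    (huX : u ∈ X) (hvZ : v ∈ Z) (hX : G.IsProperSide n v X) (hZ : G.IsProperSide n u Z)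
    {w : V} (hw : w ∈ X) (hwu : w ≠ u) : w ∈ Z := by
  by_contra hwZ
  have vu := (hv.mem u).2 (Or.inl huX)
  have vw := (hv.mem w).2 (Or.inl hw)
  have uw := hv.left huX hw hwu.symm
  have hwZ' : w ∈ Z' := ((hu.mem w).1 uw).resolve_left hwZ
  have hXp : X ⊆ {u, w} := by
    intro y hy
    simp only [Finset.mem_insert, Finset.mem_singleton]
    by_contra! hyn
    have uy := hv.left huX hy hyn.1.symm
    have vy := (hv.mem y).2 (Or.inl hy)
    have wy := hv.left hw hy hyn.2.symm
    rcases (hu.mem y).1 uy with h | h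
    · exact vy.ne (hu.left_unique w hwZ' v hvZ y h vw.symm wy)
    · exact hyn.2 (hu.right_unique v hvZ w hwZ' y h vw vy).symm
  have hX2 : X.card ≤ 2 := (Finset.card_le_card hXp).trans Finset.card_le_two
  obtain ⟨x, xv, hx, rfl⟩ := hX.resolve_left (by omega)
  have hs : ∀ s ∈ Z, s ≠ v → G.Adj v s ∧ s ∈ X' := by
    intro s hs hsv
    have vs := hu.left hvZ hs hsv.symm
    refine ⟨vs, ((hv.mem s).1 vs).resolve_left fun h => ?_⟩
    have := hXp h
    simp only [Finset.mem_insert, Finset.mem_singleton] at this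
    rcases this with rfl | rfl
    · exact G.irrefl ((hu.mem s).2 (Or.inl hs))
    · exact hwZ hs
  have hZ2 : Z.card ≤ 2 := by
    by_contra! h
    have h1 : 1 < (Z.erase v).card := by
      rw [Finset.card_erase_of_mem hvZ]
      omega
    obtain ⟨p, hp, q, hq, hpq⟩ := Finset.one_lt_card.1 h1
    rw [Finset.mem_erase] at hp hq
    exact hpq (hv.right_unique u huX p (hs p hp.2 hp.1).2 q (hs q hq.2 hq.1).2
      ((hu.mem p).2 (Or.inl hp.2)) ((hu.mem q).2 (Or.inl hq.2)))
  obtain ⟨y, yu, hy, rfl⟩ := hZ.resolve_left (by omega)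
  rw [mem_outerNeighbors] at huX hvZ hw
  have hwy : w ≠ y := by
    rintro rfl
    exact hvZ.2.2 vw.symm
  have yw : G.Adj y w := by
    by_contra h
    exact hwZ (mem_outerNeighbors.2 ⟨hwy, uw, h⟩)
  -- The overlap at v leaves at least n - 2 ≥ 2 vertices in Z, hence some s besides v.
  have h1 := hy.le_card_union yu yw hwu.symm
  have h2 := hG.card_outerNeighbors_le hn yw
  have h3 := Finset.card_union_add_card_inter (G.outerNeighbors y u) (G.outerNeighbors y w)
  have h4 : 0 < (G.outerNeighbors y u ∩ G.outerNeighbors y w).card :=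
    Finset.card_pos.2 ⟨v, Finset.mem_inter.2 ⟨mem_outerNeighbors.2 hvZ,
      mem_outerNeighbors.2 ⟨hvZ.1, vw.symm, hvZ.2.2⟩⟩⟩
  obtain ⟨s, hsZ, hsv⟩ := Finset.exists_mem_ne (show 1 < (G.outerNeighbors y u).card by omega) v
  obtain ⟨vs, hsX'⟩ := hs s hsZ hsv
  have us := (hu.mem s).2 (Or.inl hsZ)
  have hsx : s ≠ x := by
    rintro rfl
    exact huX.2.2 us.symm
  have xs : G.Adj x s := by
    by_contra h
    exact Finset.disjoint_right.1 hv.disjoint hsX' (mem_outerNeighbors.2 ⟨hsx, vs, h⟩)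
  have h5 := hx.le_card_union xv xs hsv.symm
  have h6 := Finset.card_union_add_card_inter (G.outerNeighbors x v) (G.outerNeighbors x s)
  have huxs : u ∈ G.outerNeighbors x s := mem_outerNeighbors.2 ⟨huX.1, us.symm, huX.2.2⟩
  have h7 : 0 < (G.outerNeighbors x v ∩ G.outerNeighbors x s).card :=
    Finset.card_pos.2 ⟨u, Finset.mem_inter.2 ⟨mem_outerNeighbors.2 huX, huxs⟩⟩
  have hq : ∀ q ∈ (G.outerNeighbors x s).erase u, G.Adj u q ∧ G.Adj s q ∧
      q ∈ Z' := by
    intro q hq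
    rw [Finset.mem_erase] at hq
    have uq := hG.isClique_outerNeighbors xs huxs hq.2 hq.1.symm
    have hq' := mem_outerNeighbors.1 hq.2
    refine ⟨uq, hq'.2.1, ((hu.mem q).1 uq).resolve_left fun h => ?_⟩
    have hqv : q ≠ v := by
      rintro rfl
      exact hq'.2.2 xv
    have hqX := hXp (mem_outerNeighbors.2 ⟨hq'.1, (hs q h hqv).1, hq'.2.2⟩)
    simp only [Finset.mem_insert, Finset.mem_singleton] at hqX
    rcases hqX with rfl | rfl
    · exact hq.1 rfl
    · exact hwZ h
  -- Since X has at most 2 vertices and shares u, the outer neighbourhood of s has at least 2n - 4 ≥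
  -- 4 vertices. All but u lie in Z', where s may have only one neighbour.
  have h8 : 1 < ((G.outerNeighbors x s).erase u).card := by
    rw [Finset.card_erase_of_mem huxs]
    omega
  obtain ⟨p, hp, q, hq', hpq⟩ := Finset.one_lt_card.1 h8
  exact hpq (hu.right_unique s hsZ p (hq p hp).2.2 q (hq q hq').2.2 (hq p hp).2.1 (hq q hq').2.1)

theorem ClawFree.insert_eq_of_isSplit (hG : G.ClawFree) {n : ℕ} (hn4 : 4 ≤ n)
    (hn : ∀ s : Finset V, G.IsClique (s : Set V) → s.card ≤ n + 1)
    {v u : V} {X X' Z Z' : Finset V} (hv : G.IsSplit v X X') (hu : G.IsSplit u Z Z')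
    (huX : u ∈ X) (hvZ : v ∈ Z) (hX : G.IsProperSide n v X) (hZ : G.IsProperSide n u Z) :
    insert v X = insert u Z := by
  have h1 := fun w => hG.mem_of_isSplit hn4 hn hv hu huX hvZ hX hZ (w := w)
  have h2 := fun w => hG.mem_of_isSplit hn4 hn hu hv hvZ huX hZ hX (w := w)
  ext w
  simp only [Finset.mem_insert]
  by_cases hwu : w = u
  · subst hwu; simp [huX]
  · by_cases hwv : w = v
    · subst hwv; simp [hvZ]
    · simp only [hwu, hwv, false_or]
      exact ⟨fun h => h1 w h hwu, fun h => h2 w h hwv⟩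

/-! ### From a Krausz partition to a line graph -/

/-- A Krausz partition of `G` into cliques, two through each vertex, represents `G` as a line
graph. -/
theorem exists_lineGraph_of_krausz {ω : ℕ} (S T : V → Finset V)
    (hST : ∀ v, S v ∩ T v = {v}) (hne : ∀ v, S v ≠ T v)
    (hadj : ∀ v u, u ≠ v → (G.Adj v u ↔ u ∈ S v ∨ u ∈ T v))
    (hS : ∀ v, ∀ u ∈ S v, S v = S u ∨ S v = T u) (hT : ∀ v, ∀ u ∈ T v, T v = S u ∨ T v = T u)
    (hSω : ∀ v, (S v).card ≤ ω) (hTω : ∀ v, (T v).card ≤ ω) (hω : ∃ v, (S v).card = ω) :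
    ∃ (W : Type u) (_ : Fintype W) (F : SimpleGraph W) (_ : DecidableRel F.Adj),
      F.maxDegree = ω ∧ Nonempty (G ≃g F.lineGraph) := by
  classical
  let e : V → Sym2 (Finset V) := fun v => s(S v, T v)
  have hmemST : ∀ v, v ∈ S v ∧ v ∈ T v := fun v => by
    rw [← Finset.mem_inter, hST]
    exact Finset.mem_singleton_self v
  have heq : ∀ u v, u ∈ S v → u ∈ T v → u = v := fun u v h1 h2 => by
    rw [← Finset.mem_singleton, ← hST v]
    exact Finset.mem_inter.2 ⟨h1, h2⟩
  have hmem : ∀ v u, (S v ∈ e u ↔ u ∈ S v) ∧ (T v ∈ e u ↔ u ∈ T v) := by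
    intro v u
    simp only [e, Sym2.mem_iff]
    refine ⟨⟨?_, hS v u⟩, ⟨?_, hT v u⟩⟩
    · rintro (h | h) <;> rw [h]
      exacts [(hmemST u).1, (hmemST u).2]
    · rintro (h | h) <;> rw [h]
      exacts [(hmemST u).1, (hmemST u).2]
  have hinj : Function.Injective e := by
    intro u v huv
    apply heq u v
    · rw [← (hmem v u).1, huv]
      exact Sym2.mem_mk_left _ _
    · rw [← (hmem v u).2, huv]
      exact Sym2.mem_mk_right _ _
  -- Finsets that are not of the form `S v` or `T v` become isolated vertices, harmless for the line
  -- graph and the maximum degree.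
  let F : SimpleGraph (Finset V) := fromEdgeSet (Set.range e)
  have hF : ∀ z, z ∈ F.edgeSet ↔ z ∈ Set.range e := by
    intro z
    simp only [F, edgeSet_fromEdgeSet, Set.mem_sdiff, and_iff_left_iff_imp]
    rintro ⟨v, rfl⟩
    simpa [e] using hne v
  have hFadj : ∀ K L, F.Adj K L ↔ ∃ v, e v = s(K, L) := fun K L => by
    rw [← mem_edgeSet, hF, Set.mem_range]
  refine ⟨Finset V, inferInstance, F, inferInstance, ?_, ⟨?_⟩⟩
  · have hle : ∀ K, F.degree K ≤ ω := by
      intro K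
      by_cases hK : ∃ v, K = S v ∨ K = T v
      · have hKω : K.card ≤ ω := by
          obtain ⟨v, rfl | rfl⟩ := hK
          exacts [hSω v, hTω v]
        refine le_trans ?_ hKω
        rw [← card_neighborFinset_eq_degree]
        refine le_trans (Finset.card_le_card ?_) (Finset.card_image_le (s := K)
          (f := fun v => if S v = K then T v else S v))
        intro L hL
        rw [mem_neighborFinset, hFadj] at hL
        obtain ⟨v, hv⟩ := hL
        rw [Finset.mem_image]
        rcases Sym2.eq_iff.1 hv with ⟨rfl, rfl⟩ | ⟨rfl, rfl⟩
        · exact ⟨v, (hmemST v).1, if_pos rfl⟩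
        · exact ⟨v, (hmemST v).2, if_neg (hne v)⟩
      · suffices h : F.degree K = 0 by omega
        rw [← card_neighborFinset_eq_degree, Finset.card_eq_zero, Finset.eq_empty_iff_forall_notMem]
        intro L hL
        rw [mem_neighborFinset, hFadj] at hL
        obtain ⟨v, hv⟩ := hL
        rcases Sym2.eq_iff.1 hv with ⟨rfl, rfl⟩ | ⟨rfl, rfl⟩
        exacts [hK ⟨v, Or.inl rfl⟩, hK ⟨v, Or.inr rfl⟩]
    apply le_antisymm
    · exact F.maxDegree_le_of_forall_degree_le ω hle
    · obtain ⟨v, rfl⟩ := hω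
      have hother : ∀ u ∈ S v, e u = s(S v, if S u = S v then T u else S u) := by
        intro u hu
        by_cases h : S u = S v
        · simp [e, h]
        · rw [if_neg h, (hS v u hu).resolve_left (Ne.symm h)]
          exact Sym2.eq_swap
      have hge : (S v).card ≤ F.degree (S v) := by
        rw [← card_neighborFinset_eq_degree]
        refine Finset.card_le_card_of_injOn (fun u => if S u = S v then T u else S u) ?_ ?_
        · intro u hu
          rw [Finset.mem_coe, mem_neighborFinset, hFadj]
          exact ⟨u, hother u hu⟩
        · intro u hu w hw huw
          apply hinj
          rw [hother u hu, hother w hw]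
          exact congrArg _ huw
      exact hge.trans (F.degree_le_maxDegree (S v))
  · refine ⟨Equiv.ofBijective (fun v => ⟨e v, (hF _).2 (Set.mem_range_self v)⟩) ⟨?_, ?_⟩, ?_⟩
    · intro u v h
      exact hinj (Subtype.ext_iff.1 h)
    · rintro ⟨z, hz⟩
      obtain ⟨v, rfl⟩ := (hF z).1 hz
      exact ⟨v, rfl⟩
    · intro u v
      rw [lineGraph_adj_iff_exists, (Equiv.injective _).ne_iff]
      change u ≠ v ∧ (∃ K, K ∈ e u ∧ K ∈ e v) ↔ G.Adj u v
      constructor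
      · rintro ⟨huv, K, hu, hv⟩
        rw [hadj u v (Ne.symm huv)]
        simp only [e, Sym2.mem_iff] at hu
        rcases hu with rfl | rfl
        · exact Or.inl ((hmem u v).1.1 hv)
        · exact Or.inr ((hmem u v).2.1 hv)
      · intro h
        refine ⟨h.ne, ?_⟩
        rcases (hadj u v h.ne.symm).1 h with h | h
        · exact ⟨S u, Sym2.mem_mk_left _ _, (hmem u v).1.2 h⟩
        · exact ⟨T u, Sym2.mem_mk_right _ _, (hmem u v).2.2 h⟩

end SimpleGraph

/-! ### Conclusion -/

open SimpleGraph in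
theorem theorem6p3 {V : Type u} [Fintype V] [DecidableEq V] (G : SimpleGraph V)
    [DecidableRel G.Adj] (hconn : G.Connected) (hclaw : G.ClawFree)
    (ω : ℕ) (hω : G.cliqueNum = ω) (hω5 : 5 ≤ ω) :
    (∃ (W : Type u) (_ : Fintype W) (F : SimpleGraph W) (_ : DecidableRel F.Adj),
      F.maxDegree = ω ∧ Nonempty (G ≃g F.lineGraph)) ∨
    (∃ v : V, G.square.degree v ≤ 2 * ω * (ω - 1) - 4 ∧
      ∀ x ∈ G.neighborSet v, G.square.degree x ≤ 2 * ω * (ω - 1) - 3) := by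
  obtain ⟨n, rfl⟩ : ∃ n, ω = n + 1 := ⟨ω - 1, by omega⟩
  have hn4 : 4 ≤ n := by omega
  have hn : ∀ s : Finset V, G.IsClique (s : Set V) → s.card ≤ n + 1 := fun s hs =>
    hω ▸ hs.card_le_cliqueNum
  rw [or_iff_not_imp_right]
  intro hbad
  push Not at hbad
  simp only [Nat.add_sub_cancel] at hbad
  -- The two bounds differ by one, but failing either leaves a square degree of at least 2n(n+1) -
  -- 3, at v or at a neighbour.
  have hdom : ∀ v, G.IsRich n v ∨ ∃ x, G.Adj x v ∧ G.IsRich n x := by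
    intro v
    by_cases h : 2 * (n + 1) * n ≤ G.square.degree v + 3
    · exact Or.inl (hclaw.isRich hn4 hn h)
    · obtain ⟨x, hx, hd⟩ := hbad v (by omega)
      exact Or.inr ⟨x, G.adj_symm hx, hclaw.isRich hn4 hn (by omega)⟩
  choose X Y hXY hX hY hYp using hclaw.exists_isSplit hn4 hn hdom
  have hXp : ∀ v, G.IsProperSide n v (X v) := fun v => Or.inl (hX v).ge
  have hadj : ∀ v z, G.Adj v z ↔ z ∈ X v ∨ z ∈ Y v := fun v => (hXY v).mem
  have hvX : ∀ v, v ∉ X v := fun v h => G.irrefl ((hadj v v).2 (Or.inl h))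
  have hvY : ∀ v, v ∉ Y v := fun v h => G.irrefl ((hadj v v).2 (Or.inr h))
  have hXc : ∀ v, G.IsClique ((insert v (X v) : Finset V) : Set V) := fun v =>
    isClique_insert_finset (hXY v).left fun b hb => (hadj v b).2 (Or.inl hb)
  have hYc : ∀ v, G.IsClique ((insert v (Y v) : Finset V) : Set V) := fun v =>
    isClique_insert_finset (hXY v).right fun b hb => (hadj v b).2 (Or.inr hb)
  refine exists_lineGraph_of_krausz (G := G) (fun v => insert v (X v)) (fun v => insert v (Y v))
    ?_ ?_ ?_ ?_ ?_ (fun v => hn _ (hXc v)) (fun v => hn _ (hYc v)) ?_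
  · intro v
    rw [← Finset.insert_inter_distrib, Finset.disjoint_iff_inter_eq_empty.1 (hXY v).disjoint]
    rfl
  · intro v h
    obtain ⟨y, hy⟩ := hY v
    have hyX : y ∈ insert v (X v) := h ▸ Finset.mem_insert_of_mem hy
    rcases Finset.mem_insert.1 hyX with rfl | h'
    · exact hvY y hy
    · exact Finset.disjoint_left.1 (hXY v).disjoint h' hy
  · intro v u huv
    simp [hadj, huv]
  · intro v u hu
    rcases Finset.mem_insert.1 hu with rfl | hu
    · exact Or.inl rfl
    · rcases (hadj u v).1 ((hadj v u).2 (Or.inl hu)).symm with h | h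
      · exact Or.inl (hclaw.insert_eq_of_isSplit hn4 hn (hXY v) (hXY u) hu h (hXp v) (hXp u))
      · exact Or.inr (hclaw.insert_eq_of_isSplit hn4 hn (hXY v) (hXY u).symm hu h (hXp v) (hYp u))
  · intro v u hu
    rcases Finset.mem_insert.1 hu with rfl | hu
    · exact Or.inr rfl
    · rcases (hadj u v).1 ((hadj v u).2 (Or.inr hu)).symm with h | h
      · exact Or.inl (hclaw.insert_eq_of_isSplit hn4 hn (hXY v).symm (hXY u) hu h (hYp v) (hXp u))
      · exact Or.inr
          (hclaw.insert_eq_of_isSplit hn4 hn (hXY v).symm (hXY u).symm hu h (hYp v) (hYp u))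
  · obtain ⟨v⟩ := hconn.nonempty
    exact ⟨v, by rw [Finset.card_insert_of_notMem (hvX v), hX]⟩
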